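/- Let $p$ be a prime. For an unoriented diagram $D$ of a link $L\subset S^3$, the associated core group $\Pi_L^{(2)}$ is the group with one generator for each arc of $D$ and one relator $yx^{-1}yz^{-1}$ for each crossing, where $y$ is the overpass and $x,z$ are the two underpasses at the crossing. The unreduced $p$-th Burnside group $\widehat B_L(p)$ is the group obtained from this presentation by adding all $p$-th powers of words as relators, and $\widehat B^2_L(p)=\widehat B_L(p)/\gamma_2\widehat B_L(p)$ is its quotient by the commutator subgroup $\gamma_2$. A $p$-move replaces two parallel strands of a link by $p$ half twists (a row of $p$ crossings), and two links are $p$-move equivalent if they are related by a finite sequence of $p$-moves and inverses of $p$-moves (up to isotopy). The Magnus $\mathbb Z_p$-expansion $E^p$ is the homomorphism from the free group on $x_1,\dots,x_m$ into the ring of formal power series in non-commuting variables $X_1,\dots,X_m$ over $\mathbb Z_p=\mathbb Z/p\mathbb Z$ (to its group of units) with $E^p(x_i)=1+X_i$ and $E^p(x_i^{-1})=1-X_i+X_i^2-X_i^3+\cdots$. **Theorem.** Let $L$ be a link with $\Pi_L^{(2)}\cong\langle x_1,\dots,x_m\mid R\rangle$ and $\widehat B^2_L(p)\cong\mathbb Z_p^m$.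 If $L$ is $p$-move equivalent to a trivial link, then for every $r\in R$ $$E^p(r)=1+\sum_{(i_1,\dots,i_p)\in\{1,\dots,m\}^p}c(i_1,\dots,i_p)\,X_{i_1}\cdots X_{i_p}+d(p+1)$$ for some $c(i_1,\dots,i_p)\in\mathbb Z_p$ such that $c(i_1,\dots,i_p)=c(i_{\sigma(1)},\dots,i_{\sigma(p)})$ for every permutation $\sigma$ of $\{1,\dots,p\}$, where $d(p+1)$ denotes a series all of whose terms have degree at least $p+1$. In particular, all terms of degree $1$ to $p-1$ of $E^p(r)$ vanish. -/

import Mathlib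

/-! ### Link diagrams

Unoriented link diagrams in the plane are recorded in general position with respect to a height
function.  Read from bottom to top, such a diagram is a finite sequence of horizontal slices, each
containing exactly one local minimum, local maximum or crossing, all other strands in the slice
being vertical. -/

/-- The local pictures of a slice: a local minimum `∪`, a local maximum `∩`, and the two crossings.
Both crossings exchange two adjacent strands; for `cross true` the strand running (upwards) from
left to right is the over-strand, for `cross false` the strand running from right to left is. -/
inductive Piece where
  | cup : Piece
  | cap : Piece
  | cross : Bool → Piece

/-- Number of end points on the lower boundary of a piece. -/
def Piece.bottom : Piece → ℕ
  | .cup => 0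
  | .cap => 2
  | .cross _ => 2

/-- Number of end points on the upper boundary of a piece. -/
def Piece.top : Piece → ℕ
  | .cup => 2
  | .cap => 0
  | .cross _ => 2

/-- A slice: a piece with `left` vertical strands to the left of it (the remaining strands of the
diagram pass vertically to the right of it). -/
structure Slice where
  piece : Piece
  left : ℕ

/-- Number of strands above the slice `s` if there are `n` strands below it. -/
def Slice.next (n : ℕ) (s : Slice) : ℕ := n - s.piece.bottom + s.piece.top

/-- The slices of `w` can be stacked, from bottom to top, on a level with `n` strands, and no
strand is left at the end. -/
def Fits : ℕ → List Slice → Prop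
  | n, [] => n = 0
  | n, s :: w => s.left + s.piece.bottom ≤ n ∧ Fits (s.next n) w

/-- A diagram of a link: a stack of slices with no strands at its bottom and at its top. -/
structure LinkDiagram where
  slices : List Slice
  fits : Fits 0 slices

namespace LinkDiagram

/-- The number of strands on level `k`, that is, just above the first `k` slices. -/
def width (D : LinkDiagram) (k : ℕ) : ℕ := (D.slices.take k).foldl Slice.next 0

/-- The points of the diagram on the levels between the slices: `(k, j)` is the `j`-th point from
the left (counting from `0`) on level `k`. -/
def Point (D : LinkDiagram) : Type :=
  {q : ℕ × ℕ // q.1 ≤ D.slices.length ∧ q.2 < D.width q.1}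

/-- Two points are directly joined inside one slice by a piece of the diagram that is not an
under-strand of a crossing. -/
inductive Joined (D : LinkDiagram) : D.Point → D.Point → Prop
  /-- vertical strands on the left of the piece -/
  | left (a b : D.Point) (k j : ℕ) (s : Slice) (hs : D.slices[k]? = some s) (hj : j < s.left)
      (ha : a.1 = (k, j)) (hb : b.1 = (k + 1, j)) : Joined D a b
  /-- vertical strands on the right of the piece -/
  | right (a b : D.Point) (k j : ℕ) (s : Slice) (hs : D.slices[k]? = some s)
      (ha : a.1 = (k, s.left + s.piece.bottom + j))
      (hb : b.1 = (k + 1, s.left + s.piece.top + j)) : Joined D a b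
  /-- the two ends of a local minimum -/
  | cup (a b : D.Point) (k i : ℕ) (hs : D.slices[k]? = some ⟨.cup, i⟩)
      (ha : a.1 = (k + 1, i)) (hb : b.1 = (k + 1, i + 1)) : Joined D a b
  /-- the two ends of a local maximum -/
  | cap (a b : D.Point) (k i : ℕ) (hs : D.slices[k]? = some ⟨.cap, i⟩)
      (ha : a.1 = (k, i)) (hb : b.1 = (k, i + 1)) : Joined D a b
  /-- the over-strand of a crossing, running from left to right -/
  | overRight (a b : D.Point) (k i : ℕ) (hs : D.slices[k]? = some ⟨.cross true, i⟩)
      (ha : a.1 = (k, i)) (hb : b.1 = (k + 1, i + 1)) : Joined D a b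
  /-- the over-strand of a crossing, running from right to left -/
  | overLeft (a b : D.Point) (k i : ℕ) (hs : D.slices[k]? = some ⟨.cross false, i⟩)
      (ha : a.1 = (k, i + 1)) (hb : b.1 = (k + 1, i)) : Joined D a b

/-- The arcs of the diagram: maximal pieces that do not pass under a crossing (closed curves
without under-crossings included). -/
def Arc (D : LinkDiagram) : Type := Quot D.Joined

/-- The arc through a point. -/
def arc (D : LinkDiagram) (a : D.Point) : D.Arc := Quot.mk _ a

/-- `D.IsCrossing x y z`: at some crossing of `D`, `y` lies on the overpass and `x`, `z` lie on the
two underpasses (just below and just above the crossing). -/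
inductive IsCrossing (D : LinkDiagram) : D.Point → D.Point → D.Point → Prop
  | overRight (x y z : D.Point) (k i : ℕ) (hs : D.slices[k]? = some ⟨.cross true, i⟩)
      (hx : x.1 = (k, i + 1)) (hy : y.1 = (k, i)) (hz : z.1 = (k + 1, i)) : IsCrossing D x y z
  | overLeft (x y z : D.Point) (k i : ℕ) (hs : D.slices[k]? = some ⟨.cross false, i⟩)
      (hx : x.1 = (k, i)) (hy : y.1 = (k, i + 1)) (hz : z.1 = (k + 1, i + 1)) : IsCrossing D x y z

/-- The relators `y x⁻¹ y z⁻¹` of the associated core group, one for each crossing. -/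
def coreRelators (D : LinkDiagram) : Set (FreeGroup D.Arc) :=
  {g | ∃ x y z : D.Point, D.IsCrossing x y z ∧
    g = FreeGroup.of (D.arc y) * (FreeGroup.of (D.arc x))⁻¹ *
      FreeGroup.of (D.arc y) * (FreeGroup.of (D.arc z))⁻¹}

/-- The associated core group `Π_D^{(2)}`. -/
abbrev CoreGroup (D : LinkDiagram) : Type := PresentedGroup D.coreRelators

end LinkDiagram

/-! ### Links -/

/-- The local moves generating isotopy of links on diagrams in general position with respect to the
height: planar isotopies (`exchange`, `zigzag`, `slide`) and the three Reidemeister moves.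
A list of slices is read from bottom to top. -/
inductive LocalMove : List Slice → List Slice → Prop
  /-- two pieces side by side exchange their heights -/
  | exchange (s t : Piece) (i k : ℕ) :
      LocalMove [⟨s, i⟩, ⟨t, i + s.top + k⟩] [⟨t, i + s.bottom + k⟩, ⟨s, i⟩]
  /-- a neighbouring minimum and maximum are straightened -/
  | zigzagLeft (i : ℕ) : LocalMove [⟨.cup, i⟩, ⟨.cap, i + 1⟩] []
  | zigzagRight (i : ℕ) : LocalMove [⟨.cup, i + 1⟩, ⟨.cap, i⟩] []
  /-- a strand crossing one leg of a maximum is pushed over to the other leg -/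
  | slideCap (b : Bool) (i : ℕ) :
      LocalMove [⟨.cross b, i⟩, ⟨.cap, i + 1⟩] [⟨.cross !b, i + 1⟩, ⟨.cap, i⟩]
  /-- a strand crossing one leg of a minimum is pushed over to the other leg -/
  | slideCup (b : Bool) (i : ℕ) :
      LocalMove [⟨.cup, i⟩, ⟨.cross b, i + 1⟩] [⟨.cup, i + 1⟩, ⟨.cross !b, i⟩]
  /-- first Reidemeister move -/
  | reidemeister₁Cap (b : Bool) (i : ℕ) : LocalMove [⟨.cross b, i⟩, ⟨.cap, i⟩] [⟨.cap, i⟩]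
  | reidemeister₁Cup (b : Bool) (i : ℕ) : LocalMove [⟨.cup, i⟩, ⟨.cross b, i⟩] [⟨.cup, i⟩]
  /-- second Reidemeister move -/
  | reidemeister₂ (b : Bool) (i : ℕ) : LocalMove [⟨.cross b, i⟩, ⟨.cross !b, i⟩] []
  /-- third Reidemeister move -/
  | reidemeister₃ (b : Bool) (i : ℕ) :
      LocalMove [⟨.cross b, i⟩, ⟨.cross b, i + 1⟩, ⟨.cross b, i⟩]
        [⟨.cross b, i + 1⟩, ⟨.cross b, i⟩, ⟨.cross b, i + 1⟩]

/-- `D'` arises from `D` by replacing a block of consecutive slices according to `M`. -/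
def LinkDiagram.Replace (M : List Slice → List Slice → Prop) (D D' : LinkDiagram) : Prop :=
  ∃ u a b v : List Slice, M a b ∧ D.slices = u ++ a ++ v ∧ D'.slices = u ++ b ++ v

/-- Links (isotopy classes): diagrams up to the equivalence relation generated by planar isotopy
and Reidemeister moves. -/
def Link : Type := Quot (LinkDiagram.Replace LocalMove)

/-- The link represented by a diagram. -/
def LinkDiagram.link (D : LinkDiagram) : Link := Quot.mk _ D

/-- The local change of an `n`-move: two adjacent parallel strands are replaced by `n` half twists,
that is, by `n` crossings in a row of the same kind. -/
inductive NMoveLocal (n : ℕ) : List Slice → List Slice → Prop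
  | twist (b : Bool) (i : ℕ) : NMoveLocal n [] (List.replicate n ⟨.cross b, i⟩)

namespace Link

/-- `L'` arises from `L` by an `n`-move (on suitable diagrams). -/
def NMove (n : ℕ) (L L' : Link) : Prop :=
  ∃ D D' : LinkDiagram, D.link = L ∧ D'.link = L' ∧ LinkDiagram.Replace (NMoveLocal n) D D'

/-- `n`-move equivalence of links. -/
def NMoveEquiv (n : ℕ) : Link → Link → Prop := Relation.EqvGen (NMove n)

end Link

/-- `k` disjoint round circles, one above the other. -/
def trivialSlices : ℕ → List Slice
  | 0 => []
  | k + 1 => ⟨.cup, 0⟩ :: ⟨.cap, 0⟩ :: trivialSlices k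

theorem trivialSlices_fits (k : ℕ) : Fits 0 (trivialSlices k) := by
  induction k with
  | zero => rfl
  | succ k ih => exact ⟨by simp [Piece.bottom], by simp [Slice.next, Piece.bottom, Piece.top], ih⟩

/-- The trivial link with `k` components. -/
def Link.trivial (k : ℕ) : Link := LinkDiagram.link ⟨trivialSlices k, trivialSlices_fits k⟩

/-! ### Burnside groups -/

/-- The set `W_n` of all `n`-th powers in a free group. -/
def powerWords (α : Type) (n : ℕ) : Set (FreeGroup α) := {g | ∃ w : FreeGroup α, g = w ^ n}

/-- The group `⟨α ∣ R, W_n⟩`. -/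
abbrev BurnsideGroup {α : Type} (R : Set (FreeGroup α)) (n : ℕ) : Type :=
  PresentedGroup (R ∪ powerWords α n)

/-- The quotient `G / γ_q G` (`q ≥ 1`); Mathlib numbers the lower central series from `0`. -/
abbrev GammaQuotient (G : Type) [Group G] (q : ℕ) : Type :=
  G ⧸ Subgroup.lowerCentralSeries (⊤ : Subgroup G) (q - 1)

/-- The unreduced `n`-th Burnside group of the link with diagram `D`. -/
abbrev LinkDiagram.UnreducedBurnside (D : LinkDiagram) (n : ℕ) : Type :=
  BurnsideGroup D.coreRelators n

/-! ### Formal power series in non-commuting variables and the Magnus expansion -/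

/-- Formal power series over `R` in the non-commuting variables `X_i`, `i : σ`: a series is the
function sending a word `[i₁, …, i_k]` to the coefficient of `X_{i₁} ⋯ X_{i_k}`. -/
def NCPowerSeries (σ R : Type) : Type := List σ → R

namespace NCPowerSeries

variable {σ R : Type}

/-- The coefficient of the monomial given by the word `w`. -/
def coeff (w : List σ) (f : NCPowerSeries σ R) : R := f w

@[ext]
theorem ext {f g : NCPowerSeries σ R} (h : ∀ w, coeff w f = coeff w g) : f = g := funext h

/-- The series whose coefficient at `w` is that of `f` at `a :: w`. -/
def shift (a : σ) (f : NCPowerSeries σ R) : NCPowerSeries σ R := fun w => f (a :: w)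

@[simp] theorem coeff_shift (a : σ) (w : List σ) (f : NCPowerSeries σ R) :
    coeff w (shift a f) = coeff (a :: w) f := rfl

section Ring

variable [CommRing R]

instance : AddCommGroup (NCPowerSeries σ R) := inferInstanceAs (AddCommGroup (List σ → R))

instance : Module R (NCPowerSeries σ R) := inferInstanceAs (Module R (List σ → R))

instance : One (NCPowerSeries σ R) := ⟨fun w => if w.isEmpty then 1 else 0⟩

/-- Cauchy product: sum over all factorizations of a word into two words. -/
instance : Mul (NCPowerSeries σ R) :=
  ⟨fun f g w => ∑ k ∈ Finset.range (w.length + 1), f (w.take k) * g (w.drop k)⟩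

@[simp] theorem coeff_zero (w : List σ) : coeff w (0 : NCPowerSeries σ R) = 0 := rfl

@[simp] theorem coeff_add (w : List σ) (f g : NCPowerSeries σ R) :
    coeff w (f + g) = coeff w f + coeff w g := rfl

@[simp] theorem coeff_neg (w : List σ) (f : NCPowerSeries σ R) :
    coeff w (-f) = -coeff w f := rfl

@[simp] theorem coeff_smul (w : List σ) (c : R) (f : NCPowerSeries σ R) :
    coeff w (c • f) = c * coeff w f := rfl

@[simp] theorem coeff_one_nil : coeff [] (1 : NCPowerSeries σ R) = 1 := rfl

@[simp] theorem coeff_one_cons (a : σ) (w : List σ) :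
    coeff (a :: w) (1 : NCPowerSeries σ R) = 0 := rfl

theorem coeff_mul (w : List σ) (f g : NCPowerSeries σ R) :
    coeff w (f * g) =
      ∑ k ∈ Finset.range (w.length + 1), coeff (w.take k) f * coeff (w.drop k) g := rfl

@[simp] theorem coeff_mul_nil (f g : NCPowerSeries σ R) :
    coeff [] (f * g) = coeff [] f * coeff [] g := by
  simp [coeff_mul]

theorem coeff_mul_cons (a : σ) (w : List σ) (f g : NCPowerSeries σ R) :
    coeff (a :: w) (f * g) = coeff [] f * coeff (a :: w) g + coeff w (shift a f * g) := by
  rw [coeff_mul, coeff_mul, List.length_cons, Finset.sum_range_succ', add_comm]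
  simp

theorem shift_mul (a : σ) (f g : NCPowerSeries σ R) :
    shift a (f * g) = coeff [] f • shift a g + shift a f * g := by
  ext w
  simp [coeff_mul_cons]

protected theorem add_mul (f g h : NCPowerSeries σ R) : (f + g) * h = f * h + g * h := by
  ext w
  simp [coeff_mul, add_mul, Finset.sum_add_distrib]

protected theorem mul_add (f g h : NCPowerSeries σ R) : f * (g + h) = f * g + f * h := by
  ext w
  simp [coeff_mul, mul_add, Finset.sum_add_distrib]

protected theorem zero_mul (f : NCPowerSeries σ R) : 0 * f = 0 := by
  ext w
  simp [coeff_mul]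

protected theorem mul_zero (f : NCPowerSeries σ R) : f * 0 = 0 := by
  ext w
  simp [coeff_mul]

protected theorem smul_mul (c : R) (f g : NCPowerSeries σ R) : (c • f) * g = c • (f * g) := by
  ext w
  simp [coeff_mul, Finset.mul_sum, mul_assoc]

protected theorem one_mul (f : NCPowerSeries σ R) : 1 * f = f := by
  ext w
  cases w with
  | nil => simp
  | cons a w =>
    have h : shift a (1 : NCPowerSeries σ R) = 0 := rfl
    rw [coeff_mul_cons, h, NCPowerSeries.zero_mul]
    simp

protected theorem mul_one (f : NCPowerSeries σ R) : f * 1 = f := by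
  ext w
  induction w generalizing f with
  | nil => simp
  | cons a w ih => simp [coeff_mul_cons, ih]

protected theorem mul_assoc (f g h : NCPowerSeries σ R) : f * g * h = f * (g * h) := by
  ext w
  induction w generalizing f g h with
  | nil => simp [mul_assoc]
  | cons a w ih =>
    rw [coeff_mul_cons, coeff_mul_cons, shift_mul, NCPowerSeries.add_mul, coeff_add, ih,
      NCPowerSeries.smul_mul, coeff_smul, coeff_mul_nil, coeff_mul_cons a w g h]
    ring

instance : Ring (NCPowerSeries σ R) where
  __ := (inferInstance : AddCommGroup (NCPowerSeries σ R))
  mul_assoc := NCPowerSeries.mul_assoc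
  one_mul := NCPowerSeries.one_mul
  mul_one := NCPowerSeries.mul_one
  left_distrib := NCPowerSeries.mul_add
  right_distrib := NCPowerSeries.add_mul
  zero_mul := NCPowerSeries.zero_mul
  mul_zero := NCPowerSeries.mul_zero

variable [DecidableEq σ]

/-- The variable `X_i`. -/
def X (i : σ) : NCPowerSeries σ R := fun w => if w = [i] then 1 else 0

/-- The alternating series `1 - X_i + X_i² - X_i³ + ⋯`. -/
def altX (i : σ) : NCPowerSeries σ R :=
  fun w => if w = List.replicate w.length i then (-1) ^ w.length else 0

theorem coeff_X (i : σ) (w : List σ) :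
    coeff w (X i : NCPowerSeries σ R) = if w = [i] then 1 else 0 := rfl

theorem coeff_altX (i : σ) (w : List σ) :
    coeff w (altX i : NCPowerSeries σ R) =
      if w = List.replicate w.length i then (-1) ^ w.length else 0 := rfl

theorem shift_X (a i : σ) :
    shift a (X i : NCPowerSeries σ R) = if a = i then 1 else 0 := by
  ext w
  cases w <;> by_cases h : a = i <;> simp [coeff_X, h]

theorem shift_altX (a i : σ) :
    shift a (altX i : NCPowerSeries σ R) = if a = i then -altX i else 0 := by
  ext w
  by_cases h : a = i
  · by_cases hw : w = List.replicate w.length i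
    · simp [coeff_altX, h, List.replicate_succ, ← hw, pow_succ]
    · simp [coeff_altX, h, List.replicate_succ, hw]
  · simp [coeff_altX, h, List.replicate_succ]

theorem one_add_X_mul_altX (i : σ) : (1 + X i) * altX i = (1 : NCPowerSeries σ R) := by
  ext w
  cases w with
  | nil => simp [coeff_X, coeff_altX]
  | cons a w =>
    have h : shift a (1 + X i : NCPowerSeries σ R) = if a = i then 1 else 0 := by
      rw [← shift_X]
      ext w
      simp
    rw [coeff_mul_cons, h, ← coeff_shift a w (altX i), shift_altX]
    by_cases ha : a = i <;> simp [coeff_X, ha]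

theorem altX_mul_one_add_X (i : σ) : altX i * (1 + X i) = (1 : NCPowerSeries σ R) := by
  ext w
  induction w with
  | nil => simp [coeff_X, coeff_altX]
  | cons a w ih =>
    rw [coeff_mul_cons, shift_altX]
    by_cases ha : a = i
    · rw [if_pos ha, neg_mul, coeff_neg, ih]
      cases w <;> simp [coeff_X, coeff_altX, ha]
    · simp [coeff_X, ha]

/-- The unit `1 + X_i`, with inverse `1 - X_i + X_i² - ⋯`. -/
def oneAddX (i : σ) : (NCPowerSeries σ R)ˣ :=
  ⟨1 + X i, altX i, one_add_X_mul_altX i, altX_mul_one_add_X i⟩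

end Ring

end NCPowerSeries

/-- The Magnus `ℤ/p`-expansion of the free group on `x_1, …, x_m`: the homomorphism with
`x_i ↦ 1 + X_i` and `x_i⁻¹ ↦ 1 - X_i + X_i² - ⋯`. -/
def magnus (p m : ℕ) : FreeGroup (Fin m) →* NCPowerSeries (Fin m) (ZMod p) :=
  (Units.coeHom _).comp (FreeGroup.lift NCPowerSeries.oneAddX)

/-!
Let `G` be a finite group in which every element satisfies `g ^ p = 1`. Homomorphisms from the core
group of a diagram to `G` are colorings of its arcs by `G`, and their number is an invariant of the
link. A row of `n` half twists multiplies the colors `a`, `b` of the two strands from the left by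
`(a * b⁻¹) ^ n`, or by `(b * a⁻¹) ^ n` for the other kind of crossing, so the number is even
invariant under `p`-moves. It is `|G| ^ k` for a link which is `p`-move equivalent to the trivial
link with `k` components.

For `G = ℤ/p`, the surjection from the core group onto `(ℤ/p)^m` yields at least `p ^ m`
homomorphisms, whence `m ≤ k`. For arbitrary `G`, the core group with its `m` generators therefore
has at least `|G| ^ m` homomorphisms to `G`, so every assignment of elements of `G` to the
generators extends to one: the relators are laws of `G`.

Now apply this to the image of the Magnus expansion modulo the ideal of all series of order at
least `p` with symmetric terms of degree `p`. If `f` has no constant term, then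
`(1 + f) ^ p = 1 + f ^ p` in characteristic `p`, and the terms of degree `p` of `f ^ p` are the
`p`-th power of the linear part of `f`, which is symmetric. Hence this group has exponent `p`, and
the expansion of a relator is trivial in it.
-/

/-! ### Rows of colors -/

section Row

variable {G : Type*}

/-- The row above a minimum of color `g` at the positions `i` and `i + 1`, in terms of the row `l`
below it. -/
def cupRow (i : ℕ) (g : G) (l : ℕ → G) : ℕ → G := fun j =>
  if j < i then l j else if j < i + 2 then g else l (j - 2)

theorem cupRow_inj {i : ℕ} {g g' : G} {l l' : ℕ → G} :
    cupRow i g l = cupRow i g' l' ↔ g = g' ∧ l = l' := by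
  refine ⟨fun h => ⟨by simpa [cupRow] using congrFun h i, funext fun j => ?_⟩,
    by rintro ⟨rfl, rfl⟩; rfl⟩
  rcases lt_or_ge j i with hj | hj
  · simpa [cupRow, hj] using congrFun h j
  · simpa [cupRow, show ¬ j + 2 < i by omega, hj.not_gt] using congrFun h (j + 2)

theorem cupRow_eq_cupRow_succ_iff {i : ℕ} {g h : G} {l l' : ℕ → G} :
    cupRow i g l = cupRow (i + 1) h l' ↔ l = l' ∧ g = l i ∧ h = l i := by
  constructor
  · intro e
    have e0 := congrFun e i
    have e1 := congrFun e (i + 1)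
    have e2 := congrFun e (i + 2)
    have hl : l = l' := funext fun j => by
      have ej := congrFun e j
      have ej2 := congrFun e (j + 2)
      simp only [cupRow] at e0 e1 e2 ej ej2
      grind
    simp only [cupRow] at e0 e1 e2
    grind
  · rintro ⟨rfl, rfl, rfl⟩
    funext j
    simp only [cupRow]
    grind

variable [Group G]

/-- The coloring rule of a piece, whose lower end points have the colors `l 0`, `l 1` and whose
upper end points have the colors `l' 0`, `l' 1` (as far as these end points exist): colors are
constant along arcs, and the relator of the core group holds at a crossing. -/
def Piece.Rule : Piece → (ℕ → G) → (ℕ → G) → Prop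
  | .cup, _, l' => l' 0 = l' 1
  | .cap, l, _ => l 0 = l 1
  | .cross true, l, l' => l' 1 = l 0 ∧ l' 0 = l 0 * (l 1)⁻¹ * l 0
  | .cross false, l, l' => l' 0 = l 1 ∧ l' 1 = l 1 * (l 0)⁻¹ * l 1

theorem Piece.Rule.congr {s : Piece} {l l' m m' : ℕ → G} (h : s.Rule l l')
    (hb : ∀ j < s.bottom, m j = l j) (ht : ∀ j < s.top, m' j = l' j) : s.Rule m m' := by
  rcases s with _ | _ | (_ | _) <;> simp_all [Piece.Rule, Piece.bottom, Piece.top]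

/-- The rows of colors `l` below and `l'` above the slice `s` are compatible. A row assigns a color
to every position, also to those to the right of the last strand; the latter colors are carried
along, so that the width of a level never has to be mentioned. -/
structure Slice.Step (s : Slice) (l l' : ℕ → G) : Prop where
  left : ∀ j < s.left, l' j = l j
  right : ∀ j, l' (s.left + s.piece.top + j) = l (s.left + s.piece.bottom + j)
  rule : s.piece.Rule (fun j => l (s.left + j)) (fun j => l' (s.left + j))

/-- The piece turned upside down. -/
def Piece.flip : Piece → Piece
  | .cup => .cap
  | .cap => .cup
  | .cross b => .cross !b

theorem Piece.flip_flip (s : Piece) : s.flip.flip = s := by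
  rcases s with _ | _ | (_ | _) <;> rfl

theorem Piece.bottom_flip (s : Piece) : s.flip.bottom = s.top := by cases s <;> rfl

theorem Piece.top_flip (s : Piece) : s.flip.top = s.bottom := by cases s <;> rfl

theorem Piece.Rule.flip {s : Piece} {l l' : ℕ → G} (h : s.Rule l l') : s.flip.Rule l' l := by
  rcases s with _ | _ | (_ | _)
  · exact h
  · exact h
  all_goals
    obtain ⟨h, h'⟩ := h
    exact ⟨h.symm, by rw [h, h']; group⟩

/-- The slice turned upside down. -/
def Slice.flip (s : Slice) : Slice := ⟨s.piece.flip, s.left⟩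

theorem Slice.flip_flip (s : Slice) : s.flip.flip = s :=
  congrArg (Slice.mk · s.left) s.piece.flip_flip

theorem Slice.Step.flip {s : Slice} {l l' : ℕ → G} (h : s.Step l l') : s.flip.Step l' l where
  left j hj := (h.left j hj).symm
  right j := by
    simpa only [Slice.flip, Piece.top_flip, Piece.bottom_flip] using (h.right j).symm
  rule := h.rule.flip

theorem Slice.step_flip_iff {s : Slice} {l l' : ℕ → G} : s.flip.Step l' l ↔ s.Step l l' :=
  ⟨fun h => s.flip_flip ▸ h.flip, Slice.Step.flip⟩

/-- The row above a crossing of the strands `i` and `i + 1`, in terms of the row `l` below it. -/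
def crossRow (b : Bool) (i : ℕ) (l : ℕ → G) : ℕ → G := fun j =>
  if j = i then (if b then l i * (l (i + 1))⁻¹ * l i else l (i + 1))
  else if j = i + 1 then (if b then l i else l (i + 1) * (l i)⁻¹ * l (i + 1))
  else l j

theorem step_cross_iff {b : Bool} {i : ℕ} {l l' : ℕ → G} :
    Slice.Step ⟨.cross b, i⟩ l l' ↔ l' = crossRow b i l := by
  constructor
  · intro h
    have hrule := h.rule
    funext j
    rcases lt_or_ge j i with hj | hj
    · simpa [crossRow, hj.ne, show j ≠ i + 1 by omega] using h.left j hj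
    · obtain ⟨_ | _ | k, rfl⟩ := Nat.exists_eq_add_of_le hj
      · cases b <;> simp_all [Piece.Rule, crossRow]
      · cases b <;> simp_all [Piece.Rule, crossRow]
      · have hright := h.right k
        simp only [Piece.top, Piece.bottom, add_assoc, add_comm 2 k] at hright
        simpa [crossRow, add_assoc] using hright
  · rintro rfl
    refine ⟨fun j hj => ?_, fun j => ?_, ?_⟩
    · simp only at hj
      simp [crossRow, hj.ne, show j ≠ i + 1 by omega]
    · simp [crossRow, Piece.top, Piece.bottom, add_assoc, show 2 + j ≠ 1 by omega]
    · cases b <;> simp [Piece.Rule, crossRow]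

theorem step_cup_iff {i : ℕ} {l l' : ℕ → G} :
    Slice.Step ⟨.cup, i⟩ l l' ↔ ∃ g, cupRow i g l = l' := by
  constructor
  · refine fun h => ⟨l' i, funext fun j => ?_⟩
    rcases lt_or_ge j i with hj | hj
    · simpa [cupRow, hj] using (h.left j hj).symm
    · obtain ⟨_ | _ | k, rfl⟩ := Nat.exists_eq_add_of_le hj
      · simp [cupRow]
      · simpa [cupRow, Piece.Rule] using h.rule
      · have hright := h.right k
        simp only [Piece.top, Piece.bottom, add_assoc, add_comm 2 k, zero_add] at hright
        simpa [cupRow, show i + (k + 1 + 1) - 2 = i + k by omega] using hright.symm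
  · rintro ⟨g, rfl⟩
    refine ⟨fun j hj => if_pos hj, fun j => ?_, ?_⟩
    · simp [cupRow, Piece.top, Piece.bottom, add_assoc, add_comm 2 j,
        show i + (j + 2) - 2 = i + j by omega]
    · simp [Piece.Rule, cupRow]

theorem step_cap_iff {i : ℕ} {l l' : ℕ → G} :
    Slice.Step ⟨.cap, i⟩ l l' ↔ ∃ g, cupRow i g l' = l :=
  Slice.step_flip_iff.symm.trans step_cup_iff

theorem crossRow_not_crossRow (b : Bool) (i : ℕ) (l : ℕ → G) :
    crossRow (!b) i (crossRow b i l) = l := by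
  funext j
  by_cases h0 : j = i
  · cases b <;> simp [crossRow, h0, mul_assoc]
  by_cases h1 : j = i + 1
  · cases b <;> simp [crossRow, h1, mul_assoc]
  · simp [crossRow, h0, h1]

theorem crossRow_braid (b : Bool) (i : ℕ) (l : ℕ → G) :
    crossRow b i (crossRow b (i + 1) (crossRow b i l)) =
      crossRow b (i + 1) (crossRow b i (crossRow b (i + 1) l)) := by
  have hi : i ≠ i + 1 + 1 := by omega
  funext j
  by_cases h0 : j = i
  · cases b <;> simp [crossRow, h0, hi, hi.symm, mul_assoc]
  by_cases h1 : j = i + 1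
  · cases b <;> simp [crossRow, h1, hi, hi.symm, mul_assoc]
  by_cases h2 : j = i + 1 + 1
  · cases b <;> simp [crossRow, h2, hi, hi.symm, mul_assoc]
  · simp [crossRow, h0, h1, h2]

theorem crossRow_cupRow (b : Bool) (i : ℕ) (g : G) (l : ℕ → G) :
    crossRow b i (cupRow i g l) = cupRow i g l := by
  funext j
  by_cases h0 : j = i
  · cases b <;> simp [crossRow, cupRow, h0]
  by_cases h1 : j = i + 1
  · cases b <;> simp [crossRow, cupRow, h1]
  · simp [crossRow, h0, h1]

/-- The change of the color of a minimum when a strand of color `a` is slid across it, where `b`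
says whether the strand passes over the minimum. -/
def slideColor (b : Bool) (a : G) : Equiv.Perm G where
  toFun g := if b then a * g⁻¹ * a else g
  invFun g := if b then a * g⁻¹ * a else g
  left_inv g := by cases b <;> simp [mul_assoc]
  right_inv g := by cases b <;> simp [mul_assoc]

theorem crossRow_succ_cupRow (b : Bool) (i : ℕ) (g : G) (l : ℕ → G) :
    crossRow b (i + 1) (cupRow i g l) =
      crossRow (!b) i (cupRow (i + 1) (slideColor (!b) (l i) g) l) := by
  have hi : i ≠ i + 1 + 1 := by omega
  have hi' : ¬ i + 1 + 1 < i := by omega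
  funext j
  by_cases h0 : j = i
  · cases b <;> simp [crossRow, cupRow, slideColor, h0, hi]
  by_cases h1 : j = i + 1
  · cases b <;> simp [crossRow, cupRow, slideColor, h1, hi', mul_assoc]
  by_cases h2 : j = i + 1 + 1
  · cases b <;> simp [crossRow, cupRow, slideColor, h2, hi.symm, hi', mul_assoc]
  · simp only [crossRow, cupRow, h0, h1, h2, if_false]
    grind

theorem crossRow_iterate_apply (b : Bool) (i n : ℕ) (l : ℕ → G) (j : ℕ) :
    (crossRow b i)^[n] l j =
      if j = i ∨ j = i + 1 then
        (if b then l i * (l (i + 1))⁻¹ else l (i + 1) * (l i)⁻¹) ^ n * l j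
      else l j := by
  induction n generalizing j with
  | zero => simp
  | succ n ih =>
    rw [Function.iterate_succ_apply', crossRow, ih, ih, ih]
    by_cases h0 : j = i
    · cases b <;> simp [h0, pow_succ, mul_assoc]
    by_cases h1 : j = i + 1
    · cases b <;> simp [h1, pow_succ, mul_assoc]
    · simp [h0, h1]

theorem crossRow_iterate_of_pow_eq_one {n : ℕ} (hG : ∀ g : G, g ^ n = 1) (b : Bool) (i : ℕ)
    (l : ℕ → G) : (crossRow b i)^[n] l = l := by
  funext j
  simp [crossRow_iterate_apply, hG]

end Row

/-! ### Colorings of stacks -/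

section Coloring

variable {G : Type} [Group G]

/-- Colorings of a stack of slices by `G` with prescribed rows `l` at the bottom and `l'` at the
top. -/
def Coloring : List Slice → (ℕ → G) → (ℕ → G) → Type
  | [], l, l' => PLift (l = l')
  | s :: w, l, l' => Σ m : {m : ℕ → G // s.Step l m}, Coloring w m l'

namespace Coloring

variable {s t : Slice} {w : List Slice} {l l' : ℕ → G}

instance subsingleton_nil : Subsingleton (Coloring [] l l') :=
  inferInstanceAs (Subsingleton (PLift (l = l')))

theorem nonempty_nil_iff : Nonempty (Coloring [] l l') ↔ l = l' :=
  ⟨fun ⟨h⟩ => h.down, fun h => ⟨⟨h⟩⟩⟩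

theorem nonempty_pair_iff :
    Nonempty (Coloring [s, t] l l') ↔ ∃ m, s.Step l m ∧ t.Step m l' :=
  ⟨fun ⟨m, m', h⟩ => ⟨m, m.2, h.down ▸ m'.2⟩, fun ⟨m, h, h'⟩ => ⟨⟨m, h⟩, ⟨l', h'⟩, ⟨rfl⟩⟩⟩

theorem subsingleton_pair
    (h : ∀ m m', s.Step l m → s.Step l m' → t.Step m l' → t.Step m' l' → m = m') :
    Subsingleton (Coloring [s, t] l l') where
  allEq := by
    rintro ⟨⟨m, hm⟩, ⟨n, ht⟩, ⟨e⟩⟩ ⟨⟨m', hm'⟩, ⟨n', ht'⟩, ⟨e'⟩⟩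
    obtain rfl : n = l' := e
    obtain rfl : n' = n := e'
    obtain rfl := h m m' hm hm' ht ht'
    rfl

/-- If the rows which are compatible with `l` across `s` are parametrized by `ι`, then so are the
colorings of `s`. -/
noncomputable def consEquivSigma {ι : Type} (f : ι → ℕ → G) (hf : f.Injective)
    (h : ∀ m, s.Step l m ↔ ∃ x, f x = m) :
    Coloring (s :: w) l l' ≃ Σ x, Coloring w (f x) l' :=
  (Equiv.sigmaCongrLeft (β := fun m : {m // s.Step l m} => Coloring w m.1 l') <|
    Equiv.ofBijective (fun x => ⟨f x, (h _).2 ⟨x, rfl⟩⟩)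
      ⟨fun _ _ e => hf (congrArg Subtype.val e),
        fun m => ((h m).1 m.2).imp fun _ e => Subtype.ext e⟩).symm

/-- A slice which determines the row above it does not affect the number of colorings. -/
noncomputable def consEquiv {m : ℕ → G} (h : ∀ m', s.Step l m' ↔ m' = m) :
    Coloring (s :: w) l l' ≃ Coloring w m l' :=
  (consEquivSigma (fun _ : Unit => m) (fun _ _ _ => rfl) fun m' => by
    rw [h, exists_const, eq_comm]).trans (Equiv.uniqueSigma _)

/-- A crossing determines the row above it. -/
noncomputable def crossEquiv (b : Bool) (i : ℕ) :
    Coloring (⟨.cross b, i⟩ :: w) l l' ≃ Coloring w (crossRow b i l) l' :=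
  consEquiv fun _ => step_cross_iff

/-- The color of a minimum can be chosen freely. -/
noncomputable def cupEquiv (i : ℕ) :
    Coloring (⟨.cup, i⟩ :: w) l l' ≃ Σ g, Coloring w (cupRow i g l) l' :=
  consEquivSigma (cupRow i · l) (fun _ _ e => (cupRow_inj.1 e).1) fun _ => step_cup_iff

/-- A coloring of two stacks on top of each other. -/
def appendEquiv : (u v : List Slice) → (l l' : ℕ → G) →
    Coloring (u ++ v) l l' ≃ Σ m, Coloring u l m × Coloring v m l'
  | [], v, l, l' =>
    { toFun := fun c => ⟨l, ⟨rfl⟩, c⟩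
      invFun := fun c => c.2.1.down ▸ c.2.2
      left_inv := fun _ => rfl
      right_inv := by rintro ⟨m, ⟨rfl⟩, c⟩; rfl }
  | s :: u, v, l, l' =>
    (Equiv.sigmaCongrRight fun m : {m : ℕ → G // s.Step l m} => appendEquiv u v m.1 l').trans
      { toFun := fun c => ⟨c.2.1, ⟨c.1, c.2.2.1⟩, c.2.2.2⟩
        invFun := fun c => ⟨c.2.1.1, c.1, c.2.1.2, c.2.2⟩
        left_inv := fun _ => rfl
        right_inv := fun _ => rfl }

/-- A coloring of a stack turned upside down. -/
def flipEquiv : (w : List Slice) → (l l' : ℕ → G) →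
    Coloring (w.map Slice.flip).reverse l' l ≃ Coloring w l l'
  | [], _, _ => ⟨fun h => ⟨h.down.symm⟩, fun h => ⟨h.down.symm⟩, fun _ => rfl, fun _ => rfl⟩
  | s :: w, l, l' =>
    (Equiv.cast (by rw [List.map_cons, List.reverse_cons])).trans <|
      (appendEquiv (w.map Slice.flip).reverse [s.flip] l' l).trans
      { toFun := fun ⟨m, c, m', h⟩ =>
          ⟨⟨m, Slice.step_flip_iff.1 (h.down ▸ m'.2)⟩, flipEquiv w m l' c⟩
        invFun := fun ⟨m, c⟩ => ⟨m, (flipEquiv w m l').symm c, ⟨l, m.2.flip⟩, ⟨rfl⟩⟩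
        left_inv := by rintro ⟨m, c, ⟨_, _⟩, ⟨rfl⟩⟩; simp
        right_inv := fun ⟨_, c⟩ =>
          congrArg (Sigma.mk _) ((flipEquiv w _ l').apply_symm_apply c) }

end Coloring

/-- The stacks `a` and `b` have equally many colorings by `G` for any rows at bottom and top. -/
def SameColorings (G : Type) [Group G] (a b : List Slice) : Prop :=
  ∀ l l' : ℕ → G, Nonempty (Coloring a l l' ≃ Coloring b l l')

namespace SameColorings

variable {a b : List Slice}

theorem symm (h : SameColorings G a b) : SameColorings G b a :=
  fun l l' => (h l l').map Equiv.symm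

theorem append_left (h : SameColorings G a b) (u : List Slice) :
    SameColorings G (u ++ a) (u ++ b) := fun l l' =>
  ⟨(Coloring.appendEquiv u a l l').trans <|
    (Equiv.sigmaCongrRight fun m => Equiv.prodCongr (Equiv.refl _) (h m l').some).trans
      (Coloring.appendEquiv u b l l').symm⟩

theorem append_right (h : SameColorings G a b) (v : List Slice) :
    SameColorings G (a ++ v) (b ++ v) := fun l l' =>
  ⟨(Coloring.appendEquiv a v l l').trans <|
    (Equiv.sigmaCongrRight fun m => Equiv.prodCongr (h l m).some (Equiv.refl _)).trans
      (Coloring.appendEquiv b v l l').symm⟩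

theorem flip (h : SameColorings G a b) :
    SameColorings G (a.map Slice.flip).reverse (b.map Slice.flip).reverse := fun l l' =>
  (h l' l).map fun e =>
    ((Coloring.flipEquiv a l' l).trans e).trans (Coloring.flipEquiv b l' l).symm

theorem of_subsingleton (ha : ∀ l l' : ℕ → G, Subsingleton (Coloring a l l'))
    (hb : ∀ l l' : ℕ → G, Subsingleton (Coloring b l l'))
    (h : ∀ l l' : ℕ → G, Nonempty (Coloring a l l') ↔ Nonempty (Coloring b l l')) :
    SameColorings G a b := fun l l' =>
  ⟨@equivOfSubsingletonOfSubsingleton _ _ (ha l l') (hb l l')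
    (fun c => ((h l l').1 ⟨c⟩).some) fun c => ((h l l').2 ⟨c⟩).some⟩

theorem crossings {v w : List (Bool × ℕ)}
    (h : ∀ l : ℕ → G, v.foldl (fun l x => crossRow x.1 x.2 l) l =
      w.foldl (fun l x => crossRow x.1 x.2 l) l) :
    SameColorings G (v.map fun x => ⟨.cross x.1, x.2⟩) (w.map fun x => ⟨.cross x.1, x.2⟩) := by
  have e (u : List (Bool × ℕ)) (l l' : ℕ → G) :
      Nonempty (Coloring (u.map fun x => ⟨.cross x.1, x.2⟩) l l' ≃
        Coloring [] (u.foldl (fun l x => crossRow x.1 x.2 l) l) l') := by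
    induction u generalizing l with
    | nil => exact ⟨Equiv.refl _⟩
    | cons x u ih => exact (ih _).map (Coloring.crossEquiv x.1 x.2).trans
  exact fun l l' => ⟨(e v l l').some.trans (h l ▸ (e w l l').some.symm)⟩

theorem zigzag (i : ℕ) : SameColorings G [⟨.cup, i⟩, ⟨.cap, i + 1⟩] [] := by
  refine .of_subsingleton (fun l l' => Coloring.subsingleton_pair ?_)
    (fun _ _ => inferInstance) fun l l' => ?_
  · simp only [step_cup_iff, step_cap_iff]
    rintro _ _ ⟨g, rfl⟩ ⟨g', rfl⟩ ⟨h, e⟩ ⟨h', e'⟩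
    rw [(cupRow_eq_cupRow_succ_iff.1 e.symm).2.1, (cupRow_eq_cupRow_succ_iff.1 e'.symm).2.1]
  · simp [Coloring.nonempty_pair_iff, Coloring.nonempty_nil_iff, step_cup_iff, step_cap_iff,
      eq_comm (b := cupRow i _ _), cupRow_eq_cupRow_succ_iff]

theorem slide (b : Bool) (i : ℕ) :
    SameColorings G [⟨.cup, i⟩, ⟨.cross b, i + 1⟩] [⟨.cup, i + 1⟩, ⟨.cross !b, i⟩] :=
  fun l _ => ⟨(Coloring.cupEquiv i).trans <|
    (Equiv.sigmaCongr (slideColor (!b) (l i)) fun g => (Coloring.crossEquiv b (i + 1)).trans <|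
      (Equiv.cast (by rw [crossRow_succ_cupRow])).trans (Coloring.crossEquiv (!b) i).symm).trans
    (Coloring.cupEquiv (i + 1)).symm⟩

theorem reidemeister₁ (b : Bool) (i : ℕ) :
    SameColorings G [⟨.cup, i⟩, ⟨.cross b, i⟩] [⟨.cup, i⟩] :=
  fun _ _ => ⟨(Coloring.cupEquiv i).trans <|
    (Equiv.sigmaCongrRight fun _ => (Coloring.crossEquiv b i).trans <|
      Equiv.cast (by rw [crossRow_cupRow])).trans (Coloring.cupEquiv i).symm⟩

end SameColorings

theorem Slice.Step.exists_exchange {s t : Piece} {i k : ℕ} {l m l' : ℕ → G}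
    (hs : Slice.Step ⟨s, i⟩ l m) (ht : Slice.Step ⟨t, i + s.top + k⟩ m l') :
    ∃ m', Slice.Step ⟨t, i + s.bottom + k⟩ l m' ∧ Slice.Step ⟨s, i⟩ m' l' := by
  have hsl : ∀ j < i, m j = l j := hs.left
  have hsr : ∀ j, m (i + s.top + j) = l (i + s.bottom + j) := hs.right
  have htl : ∀ j < i + s.top + k, l' j = m j := ht.left
  have htr : ∀ j, l' (i + s.top + k + t.top + j) = m (i + s.top + k + t.bottom + j) := ht.right
  let m' : ℕ → G := fun j => if j < i + s.bottom + k then l j else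
    l' (i + s.top + k + (j - (i + s.bottom + k)))
  have hm'l : ∀ j < i + s.bottom + k, m' j = l j := fun j hj => if_pos hj
  have hm'r : ∀ j, m' (i + s.bottom + k + j) = l' (i + s.top + k + j) := fun j => by simp [m']
  refine ⟨m', ⟨hm'l, fun j => ?_, ht.rule.congr (fun j _ => ?_) fun j _ => hm'r j⟩,
    ⟨fun j (hj : j < i) => ?_, fun j => ?_,
      hs.rule.congr (fun j (hj : j < s.bottom) => hm'l _ ?_) fun j (hj : j < s.top) => htl _ ?_⟩⟩
  · change m' (i + s.bottom + k + t.top + j) = l (i + s.bottom + k + t.bottom + j)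
    rw [add_assoc _ t.top, hm'r, ← add_assoc, htr]
    simpa only [add_assoc] using hsr (k + (t.bottom + j))
  · simpa only [add_assoc] using (hsr (k + j)).symm
  · rw [hm'l _ (by omega), htl _ (by omega), hsl _ hj]
  · change l' (i + s.top + j) = m' (i + s.bottom + j)
    rcases lt_or_ge j k with hj | hj
    · rw [hm'l _ (by omega), htl _ (by omega), hsr]
    · obtain ⟨n, rfl⟩ := Nat.exists_eq_add_of_le hj
      rw [← add_assoc, ← add_assoc, hm'r]
  · simp only; omega
  · simp only; omega

theorem Slice.Step.exchange_unique {s t : Piece} {i k : ℕ} {l m m' l' : ℕ → G}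
    (hm : Slice.Step ⟨s, i⟩ l m) (hm' : Slice.Step ⟨s, i⟩ l m')
    (ht : Slice.Step ⟨t, i + s.top + k⟩ m l') (ht' : Slice.Step ⟨t, i + s.top + k⟩ m' l') :
    m = m' := by
  funext j
  rcases lt_or_ge j (i + s.top) with hj | hj
  · exact (ht.left j (by simp only; omega)).symm.trans (ht'.left j (by simp only; omega))
  · obtain ⟨n, rfl⟩ := Nat.exists_eq_add_of_le hj
    exact (hm.right n).trans (hm'.right n).symm

theorem SameColorings.exchange (s t : Piece) (i k : ℕ) :
    SameColorings G [⟨s, i⟩, ⟨t, i + s.top + k⟩] [⟨t, i + s.bottom + k⟩, ⟨s, i⟩] := by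
  have hflip {m m' : ℕ → G} : Slice.Step ⟨t, i + s.bottom + k⟩ m m' ↔
      Slice.Step ⟨t.flip, i + s.flip.top + k⟩ m' m := by
    rw [← Slice.step_flip_iff, Slice.flip, Piece.top_flip]
  refine .of_subsingleton
    (fun l l' => Coloring.subsingleton_pair fun m m' => Slice.Step.exchange_unique)
    (fun l l' => Coloring.subsingleton_pair fun m m' ht ht' hm hm' =>
      Slice.Step.exchange_unique hm.flip hm'.flip (hflip.1 ht) (hflip.1 ht'))
    fun l l' => ?_
  rw [Coloring.nonempty_pair_iff, Coloring.nonempty_pair_iff]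
  refine ⟨fun ⟨m, hs, ht⟩ => hs.exists_exchange ht, fun ⟨m, ht, hs⟩ => ?_⟩
  obtain ⟨m', ht', hs'⟩ := hs.flip.exists_exchange (hflip.1 ht)
  refine ⟨m', Slice.step_flip_iff.1 hs', Slice.step_flip_iff.1 ?_⟩
  rwa [Slice.flip, ← Piece.bottom_flip]

theorem LocalMove.sameColorings {a b : List Slice} (h : LocalMove a b) :
    SameColorings G a b := by
  cases h with
  | exchange s t i k => exact .exchange s t i k
  | zigzagLeft i => exact .zigzag i
  | zigzagRight i => exact (SameColorings.zigzag i).flip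
  | slideCap b i => simpa [Slice.flip, Piece.flip] using (SameColorings.slide b i).flip.symm
  | slideCup b i => exact .slide b i
  | reidemeister₁Cap b i =>
    simpa [Slice.flip, Piece.flip] using (SameColorings.reidemeister₁ (!b) i).flip
  | reidemeister₁Cup b i => exact .reidemeister₁ b i
  | reidemeister₂ b i =>
    exact .crossings (v := [(b, i), (!b, i)]) (w := []) (crossRow_not_crossRow b i)
  | reidemeister₃ b i =>
    exact .crossings (v := [(b, i), (b, i + 1), (b, i)]) (w := [(b, i + 1), (b, i), (b, i + 1)])
      (crossRow_braid b i)

theorem NMoveLocal.sameColorings {n : ℕ} (hG : ∀ g : G, g ^ n = 1) {a b : List Slice}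
    (h : NMoveLocal n a b) : SameColorings G a b := by
  obtain ⟨b, i⟩ := h
  have htwist (l : ℕ → G) : (List.replicate n (b, i)).foldl (fun l x => crossRow x.1 x.2 l) l =
      (crossRow b i)^[n] l := by
    generalize n = k
    induction k generalizing l with
    | zero => rfl
    | succ _ ih => exact ih _
  simpa using SameColorings.crossings (v := []) (w := List.replicate n (b, i)) fun l =>
    ((htwist l).trans (crossRow_iterate_of_pow_eq_one hG b i l)).symm

end Coloring

/-! ### Colorings and homomorphisms from the core group -/

section CoreGroup

variable {G : Type} [Group G]

theorem Fits.bottom_le {n : ℕ} {w : List Slice} (h : Fits n w) {k : ℕ} {s : Slice}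
    (hs : w[k]? = some s) : s.left + s.piece.bottom ≤ (w.take k).foldl Slice.next n := by
  induction w generalizing n k with
  | nil => simp at hs
  | cons t w ih =>
    cases k with
    | zero =>
      obtain rfl : t = s := by simpa using hs
      exact h.1
    | succ k => exact ih h.2 (by simpa using hs)

theorem Fits.foldl_next {n : ℕ} {w : List Slice} (h : Fits n w) : w.foldl Slice.next n = 0 := by
  induction w generalizing n with
  | nil => exact h
  | cons t w ih => exact ih h.2

/-- Colorings of all positions on all levels of a stack of slices `w`, with the row `l` at the
bottom and the row `l'` on all levels from the top on. -/
@[ext]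
structure LevelColoring (G : Type) [Group G] (w : List Slice) (l l' : ℕ → G) where
  /-- The color of a position on a level. -/
  color : ℕ → ℕ → G
  color_zero : color 0 = l
  color_of_length_le : ∀ k, w.length ≤ k → color k = l'
  step : ∀ (k : ℕ) (s : Slice), w[k]? = some s → s.Step (color k) (color (k + 1))

namespace LevelColoring

variable {s : Slice} {w : List Slice} {l l' m : ℕ → G}

/-- Adding a slice at the bottom of a coloring. -/
def cons (h : s.Step l m) (c : LevelColoring G w m l') : LevelColoring G (s :: w) l l' where
  color k := k.casesOn l c.color
  color_zero := rfl
  color_of_length_le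
    | k + 1, hk => c.color_of_length_le k (Nat.le_of_succ_le_succ hk)
  step
    | 0, t, ht => by
      obtain rfl : s = t := by simpa using ht
      change s.Step l (c.color 0)
      rwa [c.color_zero]
    | k + 1, t, ht => c.step k t ht

theorem step_zero (c : LevelColoring G (s :: w) l l') : s.Step l (c.color 1) := by
  have h := c.step 0 s rfl
  rwa [c.color_zero] at h

/-- Removing the bottom slice from a coloring. -/
def tail (c : LevelColoring G (s :: w) l l') : LevelColoring G w (c.color 1) l' where
  color k := c.color (k + 1)
  color_zero := rfl
  color_of_length_le k hk := c.color_of_length_le (k + 1) (Nat.succ_le_succ hk)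
  step k t ht := c.step (k + 1) t ht

/-- Colorings of a stack, given row by row. -/
def equivColoring : (w : List Slice) → (l l' : ℕ → G) → LevelColoring G w l l' ≃ Coloring w l l'
  | [], l, l' =>
    { toFun := fun c => ⟨c.color_zero.symm.trans (c.color_of_length_le 0 le_rfl)⟩
      invFun := fun h => ⟨fun _ => l, rfl, fun _ _ => h.down, by simp⟩
      left_inv := fun c => LevelColoring.ext <| funext fun k =>
        c.color_zero.symm.trans <| (c.color_of_length_le 0 (Nat.zero_le _)).trans
          (c.color_of_length_le k (Nat.zero_le _)).symm
      right_inv := fun _ => rfl }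
  | s :: w, l, l' =>
    Equiv.trans
      { toFun := fun c => ⟨⟨c.color 1, c.step_zero⟩, c.tail⟩
        invFun := fun c => c.2.cons c.1.2
        left_inv := fun c => LevelColoring.ext <| funext fun k => by
          cases k with
          | zero => exact c.color_zero.symm
          | succ k => rfl
        right_inv := by
          rintro ⟨⟨m, hm⟩, c, h, hc⟩
          obtain rfl : c 0 = m := h
          rfl }
      (Equiv.sigmaCongrRight fun m : {m : ℕ → G // s.Step l m} => equivColoring w m.1 l')

end LevelColoring

namespace LinkDiagram

variable (D : LinkDiagram)

theorem bottom_le_width {k : ℕ} {s : Slice} (hs : D.slices[k]? = some s) :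
    s.left + s.piece.bottom ≤ D.width k := D.fits.bottom_le hs

theorem width_succ {k : ℕ} {s : Slice} (hs : D.slices[k]? = some s) :
    D.width (k + 1) = D.width k - s.piece.bottom + s.piece.top := by
  rw [width, List.take_add_one, hs, List.foldl_append]
  rfl

theorem width_of_length_le {k : ℕ} (hk : D.slices.length ≤ k) : D.width k = 0 := by
  rw [width, List.take_of_length_le hk, D.fits.foldl_next]

/-- Colorings of the points of a diagram which are constant along arcs and satisfy the relations of
the core group. -/
@[ext]
structure PointColoring (G : Type) [Group G] (D : LinkDiagram) where
  /-- The color of a point. -/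
  color : D.Point → G
  joined : ∀ a b, D.Joined a b → color a = color b
  crossing : ∀ x y z, D.IsCrossing x y z → color z = color y * (color x)⁻¹ * color y

/-- The color of an arc. -/
def PointColoring.arcColor {D : LinkDiagram} (c : PointColoring G D) : D.Arc → G :=
  Quot.lift c.color c.joined

/-- Homomorphisms from the core group are colorings. -/
def homEquivPointColoring : (D.CoreGroup →* G) ≃ PointColoring G D where
  toFun f :=
    { color := fun a => f (PresentedGroup.of (D.arc a))
      joined := fun _ _ h => congrArg (fun x => f (PresentedGroup.of x)) (Quot.sound h)
      crossing := fun x y z h => by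
        have hrel : PresentedGroup.mk D.coreRelators _ = 1 :=
          PresentedGroup.one_of_mem ⟨x, y, z, h, rfl⟩
        exact (mul_inv_eq_one.1 (by simpa [PresentedGroup.of] using congrArg f hrel)).symm }
  invFun c := PresentedGroup.toGroup (f := c.arcColor) (by
    rintro _ ⟨x, y, z, h, rfl⟩
    simp only [map_mul, map_inv, FreeGroup.lift_apply_of, mul_inv_eq_one]
    exact (c.crossing x y z h).symm)
  left_inv f := by
    ext ⟨a⟩
    exact PresentedGroup.toGroup.of _
  right_inv c := PointColoring.ext (funext fun a => PresentedGroup.toGroup.of _)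

open Classical in
/-- Extension of a coloring of the points by `1` to all positions on all levels. -/
noncomputable def extendOne (c : D.Point → G) (k j : ℕ) : G :=
  if h : k ≤ D.slices.length ∧ j < D.width k then c ⟨(k, j), h⟩ else 1

theorem extendOne_of_mem (c : D.Point → G) {k j : ℕ}
    (h : k ≤ D.slices.length ∧ j < D.width k) : D.extendOne c k j = c ⟨(k, j), h⟩ := dif_pos h

theorem extendOne_of_width_le (c : D.Point → G) {k j : ℕ} (h : D.width k ≤ j) :
    D.extendOne c k j = 1 := dif_neg fun h' => absurd h'.2 (not_lt.2 h)

variable {D}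

theorem PointColoring.rule (c : PointColoring G D) {k : ℕ} {s : Slice}
    (hs : D.slices[k]? = some s) :
    s.piece.Rule (fun j => D.extendOne c.color k (s.left + j))
      (fun j => D.extendOne c.color (k + 1) (s.left + j)) := by
  have hbottom := D.bottom_le_width hs
  have hwidth := D.width_succ hs
  have hk : k < D.slices.length := (List.getElem?_eq_some_iff.1 hs).1
  have lower j (hj : j < s.piece.bottom) :=
    D.extendOne_of_mem c.color (k := k) (j := s.left + j) ⟨hk.le, by omega⟩
  have upper j (hj : j < s.piece.top) :=
    D.extendOne_of_mem c.color (k := k + 1) (j := s.left + j) ⟨hk, by omega⟩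
  obtain ⟨_ | _ | (_ | _), i⟩ := s
  · exact (upper 0 two_pos).trans <|
      (c.joined _ _ (.cup _ _ k i hs rfl rfl)).trans (upper 1 one_lt_two).symm
  · exact (lower 0 two_pos).trans <|
      (c.joined _ _ (.cap _ _ k i hs rfl rfl)).trans (lower 1 one_lt_two).symm
  · dsimp only [Piece.Rule]
    rw [lower 0 two_pos, lower 1 one_lt_two, upper 0 two_pos, upper 1 one_lt_two]
    exact ⟨(c.joined _ _ (.overLeft _ _ k i hs rfl rfl)).symm,
      c.crossing _ _ _ (.overLeft _ _ _ k i hs rfl rfl rfl)⟩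
  · dsimp only [Piece.Rule]
    rw [lower 0 two_pos, lower 1 one_lt_two, upper 0 two_pos, upper 1 one_lt_two]
    exact ⟨(c.joined _ _ (.overRight _ _ k i hs rfl rfl)).symm,
      c.crossing _ _ _ (.overRight _ _ _ k i hs rfl rfl rfl)⟩

theorem PointColoring.step (c : PointColoring G D) {k : ℕ} {s : Slice}
    (hs : D.slices[k]? = some s) :
    s.Step (D.extendOne c.color k) (D.extendOne c.color (k + 1)) := by
  have hbottom := D.bottom_le_width hs
  have hwidth := D.width_succ hs
  have hk : k < D.slices.length := (List.getElem?_eq_some_iff.1 hs).1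
  refine ⟨fun j hj => ?_, fun j => ?_, c.rule hs⟩
  · rw [D.extendOne_of_mem c.color (k := k) (j := j) ⟨hk.le, by omega⟩,
      D.extendOne_of_mem c.color (k := k + 1) (j := j) ⟨hk, by omega⟩]
    exact (c.joined _ _ (.left _ _ k j s hs hj rfl rfl)).symm
  · rcases lt_or_ge (s.left + s.piece.bottom + j) (D.width k) with hj | hj
    · rw [D.extendOne_of_mem c.color (k := k) ⟨hk.le, hj⟩,
        D.extendOne_of_mem c.color (k := k + 1) ⟨hk, by omega⟩]
      exact (c.joined _ _ (.right _ _ k j s hs rfl rfl)).symm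
    · rw [D.extendOne_of_width_le c.color hj, D.extendOne_of_width_le c.color (by omega)]

/-- Extension of a coloring of the points by `1`. -/
noncomputable def PointColoring.extend (c : PointColoring G D) :
    LevelColoring G D.slices 1 1 where
  color := D.extendOne c.color
  color_zero := funext fun j => D.extendOne_of_width_le c.color (Nat.zero_le j)
  color_of_length_le _ hk := funext fun j =>
    D.extendOne_of_width_le c.color ((D.width_of_length_le hk).trans_le (Nat.zero_le j))
  step _ _ := c.step

/-- Restriction of a coloring of all positions to the points of the diagram. -/
def restrict (c : LevelColoring G D.slices 1 1) : PointColoring G D where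
  color a := c.color a.1.1 a.1.2
  joined := by
    rintro a b (⟨k, j, s, hs, hj, ha, hb⟩ | ⟨k, j, s, hs, ha, hb⟩ | ⟨k, i, hs, ha, hb⟩ |
      ⟨k, i, hs, ha, hb⟩ | ⟨k, i, hs, ha, hb⟩ | ⟨k, i, hs, ha, hb⟩) <;>
      rw [ha, hb]
    · exact ((c.step k s hs).left j hj).symm
    · exact ((c.step k s hs).right j).symm
    · exact (c.step k _ hs).rule
    · exact (c.step k _ hs).rule
    · exact (c.step k _ hs).rule.1.symm
    · exact (c.step k _ hs).rule.1.symm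
  crossing := by
    rintro x y z (⟨k, i, hs, hx, hy, hz⟩ | ⟨k, i, hs, hx, hy, hz⟩) <;> rw [hx, hy, hz]
    · exact (c.step k _ hs).rule.2
    · exact (c.step k _ hs).rule.2

theorem color_eq_one_of_width_le (c : LevelColoring G D.slices 1 1) {k j : ℕ}
    (hj : D.width k ≤ j) : c.color k j = 1 := by
  induction k generalizing j with
  | zero => rw [c.color_zero, Pi.one_apply]
  | succ k ih =>
    rcases lt_or_ge k D.slices.length with hk | hk
    · have hs := List.getElem?_eq_getElem hk
      have hbottom := D.bottom_le_width hs
      have hwidth := D.width_succ hs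
      obtain ⟨n, rfl⟩ := Nat.exists_eq_add_of_le
        (show D.slices[k].left + D.slices[k].piece.top ≤ j by omega)
      rw [(c.step k _ hs).right, ih (by omega)]
    · rw [c.color_of_length_le _ (by omega), Pi.one_apply]

variable (D) in
/-- A coloring of all positions is determined by the colors of the points. -/
noncomputable def levelColoringEquiv : LevelColoring G D.slices 1 1 ≃ PointColoring G D where
  toFun := restrict
  invFun := PointColoring.extend
  left_inv c := LevelColoring.ext <| funext fun k => funext fun j => by
    rcases lt_or_ge j (D.width k) with hj | hj
    · refine D.extendOne_of_mem _ ⟨not_lt.1 fun hk => ?_, hj⟩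
      rw [D.width_of_length_le hk.le] at hj
      exact Nat.not_lt_zero _ hj
    · exact (D.extendOne_of_width_le _ hj).trans (color_eq_one_of_width_le c hj).symm
  right_inv c := PointColoring.ext (funext fun a => D.extendOne_of_mem c.color a.2)

variable (G D) in
/-- Colorings of the slices of a diagram are homomorphisms from its core group. -/
noncomputable def coloringEquivHom : Coloring D.slices (1 : ℕ → G) 1 ≃ (D.CoreGroup →* G) :=
  ((LevelColoring.equivColoring _ _ _).symm.trans D.levelColoringEquiv).trans
    D.homEquivPointColoring.symm

theorem Replace.card_hom_eq {D' : LinkDiagram} {M : List Slice → List Slice → Prop}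
    (hM : ∀ {a b}, M a b → SameColorings G a b) (h : Replace M D D') :
    Nat.card (D.CoreGroup →* G) = Nat.card (D'.CoreGroup →* G) := by
  obtain ⟨u, a, b, v, hab, hD, hD'⟩ := h
  obtain ⟨e⟩ := ((hM hab).append_left u).append_right v 1 1
  rw [← hD, ← hD'] at e
  exact Nat.card_congr (((D.coloringEquivHom G).symm.trans e).trans (D'.coloringEquivHom G))

end LinkDiagram

/-! ### The number of homomorphisms from the core group of a link -/

namespace Link

/-- The number of homomorphisms from the core group of a link to the group `G`. -/
noncomputable def cardHom (G : Type) [Group G] : Link → ℕ :=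
  Quot.lift (fun D => Nat.card (D.CoreGroup →* G)) fun _ _ h =>
    h.card_hom_eq LocalMove.sameColorings

theorem NMoveEquiv.cardHom_eq {n : ℕ} (hG : ∀ g : G, g ^ n = 1) {L L' : Link}
    (h : NMoveEquiv n L L') : L.cardHom G = L'.cardHom G := by
  induction h with
  | rel _ _ h =>
    obtain ⟨D, D', rfl, rfl, h⟩ := h
    exact h.card_hom_eq (NMoveLocal.sameColorings hG)
  | refl _ => rfl
  | symm _ _ _ ih => exact ih.symm
  | trans _ _ _ _ _ ih ih' => exact ih.trans ih'

end Link

theorem card_coloring_trivialSlices (k : ℕ) (l : ℕ → G) :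
    Nat.card (Coloring (trivialSlices k) l l) = Nat.card G ^ k := by
  induction k with
  | zero =>
    have : Nonempty (Coloring (trivialSlices 0) l l) := Coloring.nonempty_nil_iff.2 rfl
    have : Subsingleton (Coloring (trivialSlices 0) l l) := Coloring.subsingleton_nil
    simp
  | succ k ih =>
    have hcap (g : G) (m : ℕ → G) : Slice.Step ⟨.cap, 0⟩ (cupRow 0 g l) m ↔ m = l := by
      simp [step_cap_iff, cupRow_inj]
    have e : Coloring (trivialSlices (k + 1)) l l ≃ G × Coloring (trivialSlices k) l l :=
      (Coloring.cupEquiv 0).trans <|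
        (Equiv.sigmaCongrRight fun g => Coloring.consEquiv (hcap g)).trans
          (Equiv.sigmaEquivProd _ _)
    rw [Nat.card_congr e, Nat.card_prod, ih, pow_succ']

theorem Link.cardHom_trivial (k : ℕ) : (Link.trivial k).cardHom G = Nat.card G ^ k :=
  (Nat.card_congr (LinkDiagram.coloringEquivHom G ⟨_, trivialSlices_fits k⟩).symm).trans
    (card_coloring_trivialSlices k 1)

end CoreGroup

/-! ### Series of given order -/

namespace NCPowerSeries

variable {σ R : Type} [CommRing R]

/-- The constant term, as a ring homomorphism. -/
def constantCoeff (σ R : Type) [CommRing R] : NCPowerSeries σ R →+* R where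
  toFun := coeff []
  map_one' := rfl
  map_mul' := coeff_mul_nil
  map_zero' := rfl
  map_add' := coeff_add []

theorem constantCoeff_apply (f : NCPowerSeries σ R) : constantCoeff σ R f = coeff [] f := rfl

instance charP (p : ℕ) [CharP R p] : CharP (NCPowerSeries σ R) p where
  cast_eq_zero_iff n := by
    rw [← CharP.cast_eq_zero_iff R p n]
    constructor
    · intro h
      rw [← map_natCast (constantCoeff σ R), h, map_zero]
    · intro h
      rw [← nsmul_one, ← Nat.cast_smul_eq_nsmul R, h, zero_smul]

theorem coeff_eq_zero_of_mul_of_order {m n : ℕ} {f g : NCPowerSeries σ R}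
    (hf : ∀ w : List σ, w.length < m → coeff w f = 0)
    (hg : ∀ w : List σ, w.length < n → coeff w g = 0)
    {w : List σ} (hw : w.length < m + n) : coeff w (f * g) = 0 := by
  rw [coeff_mul]
  refine Finset.sum_eq_zero fun k hk => ?_
  have hk' := Finset.mem_range.1 hk
  rcases lt_or_ge k m with h | h
  · rw [hf _ (by rw [List.length_take]; omega), zero_mul]
  · rw [hg _ (by rw [List.length_drop]; omega), mul_zero]

/-- The two-sided ideal of the series all of whose terms have degree at least `n`. -/
def ofOrder (σ R : Type) [CommRing R] (n : ℕ) : TwoSidedIdeal (NCPowerSeries σ R) :=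
  .mk' {f | ∀ w : List σ, w.length < n → coeff w f = 0}
    (fun _ _ => rfl)
    (fun hf hg w hw => by rw [coeff_add, hf w hw, hg w hw, add_zero])
    (fun hf w hw => by rw [coeff_neg, hf w hw, neg_zero])
    (fun hg _ hw => coeff_eq_zero_of_mul_of_order (m := 0)
      (fun _ h => absurd h (Nat.not_lt_zero _)) hg (by rwa [zero_add]))
    (fun hf _ hw => coeff_eq_zero_of_mul_of_order (n := 0)
      hf (fun _ h => absurd h (Nat.not_lt_zero _)) hw)

theorem mem_ofOrder {n : ℕ} {f : NCPowerSeries σ R} :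
    f ∈ ofOrder σ R n ↔ ∀ w : List σ, w.length < n → coeff w f = 0 :=
  TwoSidedIdeal.mem_mk' _ _ _ _ _ _ _

theorem ofOrder_anti : Antitone (ofOrder σ R) := fun _ _ h _ hf =>
  mem_ofOrder.2 fun w hw => mem_ofOrder.1 hf w (hw.trans_le h)

theorem mul_mem_ofOrder {m n : ℕ} {f g : NCPowerSeries σ R} (hf : f ∈ ofOrder σ R m)
    (hg : g ∈ ofOrder σ R n) : f * g ∈ ofOrder σ R (m + n) :=
  mem_ofOrder.2 fun _ => coeff_eq_zero_of_mul_of_order (mem_ofOrder.1 hf) (mem_ofOrder.1 hg)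

theorem mem_ofOrder_one {f : NCPowerSeries σ R} : f ∈ ofOrder σ R 1 ↔ coeff [] f = 0 := by
  simp [mem_ofOrder]

theorem pow_mem_ofOrder {f : NCPowerSeries σ R} (hf : coeff [] f = 0) (n : ℕ) :
    f ^ n ∈ ofOrder σ R n := by
  induction n with
  | zero => exact mem_ofOrder.2 fun w hw => absurd hw (Nat.not_lt_zero _)
  | succ n ih => rw [pow_succ]; exact mul_mem_ofOrder ih (mem_ofOrder_one.2 hf)

theorem coeff_mul_of_mem_ofOrder_right {f g : NCPowerSeries σ R} {w : List σ}
    (hg : g ∈ ofOrder σ R w.length) : coeff w (f * g) = coeff [] f * coeff w g := by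
  rw [coeff_mul, Finset.sum_range_succ', Finset.sum_eq_zero, zero_add, List.take_zero,
    List.drop_zero]
  intro k hk
  have hk' := Finset.mem_range.1 hk
  rw [mem_ofOrder.1 hg _ (by rw [List.length_drop]; omega), mul_zero]

theorem coeff_mul_of_mem_ofOrder_left {f g : NCPowerSeries σ R} {w : List σ}
    (hf : f ∈ ofOrder σ R w.length) : coeff w (f * g) = coeff w f * coeff [] g := by
  rw [coeff_mul, Finset.sum_range_succ, Finset.sum_eq_zero, zero_add, List.take_length,
    List.drop_length]
  intro k hk
  have hk' := Finset.mem_range.1 hk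
  rw [mem_ofOrder.1 hf _ (by rw [List.length_take]; omega), zero_mul]

theorem coeff_pow_length {f : NCPowerSeries σ R} (hf : coeff [] f = 0) (w : List σ) :
    coeff w (f ^ w.length) = (w.map fun a => coeff [a] f).prod := by
  induction w with
  | nil => simp
  | cons a w ih =>
    rw [List.length_cons, pow_succ', coeff_mul_cons, hf, zero_mul, zero_add,
      coeff_mul_of_mem_ofOrder_right (pow_mem_ofOrder hf _), ih, coeff_shift, List.map_cons,
      List.prod_cons]

/-! ### Series with symmetric leading terms -/

/-- The two-sided ideal of the series whose terms all have degree at least `n` and whose terms of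
degree `n` are symmetric: permuting the letters of a word of length `n` preserves the
coefficient. -/
def symmetricOrder (σ R : Type) [CommRing R] (n : ℕ) : TwoSidedIdeal (NCPowerSeries σ R) :=
  .mk' {f | f ∈ ofOrder σ R n ∧ ∀ v w : List σ, v.length = n → v.Perm w → coeff v f = coeff w f}
    ⟨zero_mem _, fun _ _ _ _ => rfl⟩
    (fun hf hg => ⟨add_mem hf.1 hg.1, fun v w hv h => by
      rw [coeff_add, coeff_add, hf.2 v w hv h, hg.2 v w hv h]⟩)
    (fun hf => ⟨neg_mem hf.1, fun v w hv h => by rw [coeff_neg, coeff_neg, hf.2 v w hv h]⟩)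
    (fun {f g} hg => ⟨(ofOrder σ R n).mul_mem_left _ _ hg.1, fun v w hv h => by
      rw [coeff_mul_of_mem_ofOrder_right (hv ▸ hg.1),
        coeff_mul_of_mem_ofOrder_right (h.length_eq ▸ hv ▸ hg.1), hg.2 v w hv h]⟩)
    (fun {f g} hf => ⟨(ofOrder σ R n).mul_mem_right _ _ hf.1, fun v w hv h => by
      rw [coeff_mul_of_mem_ofOrder_left (hv ▸ hf.1),
        coeff_mul_of_mem_ofOrder_left (h.length_eq ▸ hv ▸ hf.1), hf.2 v w hv h]⟩)

theorem mem_symmetricOrder {n : ℕ} {f : NCPowerSeries σ R} :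
    f ∈ symmetricOrder σ R n ↔ f ∈ ofOrder σ R n ∧
      ∀ v w : List σ, v.length = n → v.Perm w → coeff v f = coeff w f :=
  TwoSidedIdeal.mem_mk' _ _ _ _ _ _ _

theorem ofOrder_succ_le_symmetricOrder (n : ℕ) :
    ofOrder σ R (n + 1) ≤ symmetricOrder σ R n := fun f hf => by
  have hf' := mem_ofOrder.1 hf
  refine mem_symmetricOrder.2 ⟨ofOrder_anti n.le_succ hf, fun v w hv h => ?_⟩
  rw [hf' v (by omega), hf' w (by rw [← h.length_eq]; omega)]

theorem pow_mem_symmetricOrder {f : NCPowerSeries σ R} (hf : coeff [] f = 0) (n : ℕ) :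
    f ^ n ∈ symmetricOrder σ R n := by
  refine mem_symmetricOrder.2 ⟨pow_mem_ofOrder hf n, ?_⟩
  rintro v w rfl h
  rw [coeff_pow_length hf v, h.length_eq, coeff_pow_length hf w]
  exact (h.map _).prod_eq

theorem pow_char_sub_one_mem_symmetricOrder (p : ℕ) [Fact p.Prime] [CharP R p]
    {f : NCPowerSeries σ R} (hf : coeff [] f = 1) : f ^ p - 1 ∈ symmetricOrder σ R p := by
  have hf' : coeff [] (f - 1) = 0 := by
    rw [← constantCoeff_apply, map_sub, map_one, constantCoeff_apply, hf, sub_self]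
  simpa [sub_pow_char_of_commute p (Commute.one_right f)] using pow_mem_symmetricOrder hf' p

instance finite_quotient_symmetricOrder [Finite σ] [Finite R] (n : ℕ) :
    Finite (symmetricOrder σ R n).ringCon.Quotient := by
  have : Finite {w : List σ // w.length < n + 1} := (List.finite_length_lt σ (n + 1)).to_subtype
  let extend (c : {w : List σ // w.length < n + 1} → R) : NCPowerSeries σ R :=
    fun w => if h : w.length < n + 1 then c ⟨w, h⟩ else 0
  refine Finite.of_surjective (fun c => (extend c : (symmetricOrder σ R n).ringCon.Quotient))
    fun q => ?_
  obtain ⟨f, rfl⟩ := (symmetricOrder σ R n).ringCon.mk'_surjective q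
  refine ⟨fun w => coeff w.1 f, (RingCon.eq _).2 ((TwoSidedIdeal.rel_iff _ _ _).2 ?_)⟩
  refine ofOrder_succ_le_symmetricOrder n (mem_ofOrder.2 fun w hw => ?_)
  rw [sub_eq_add_neg, coeff_add, coeff_neg, add_neg_eq_zero]
  exact dif_pos hw

section Monomial

variable [DecidableEq σ]

theorem coeff_prod_map_X (v w : List σ) :
    coeff w ((v.map X).prod : NCPowerSeries σ R) = if w = v then 1 else 0 := by
  induction v generalizing w with
  | nil => cases w <;> simp
  | cons a v ih =>
    cases w with
    | nil => simp [coeff_X]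
    | cons b w =>
      rw [List.map_cons, List.prod_cons, coeff_mul_cons, shift_X]
      by_cases h : b = a <;> simp [coeff_X, h, ih]

variable [Fintype σ] {n : ℕ}

theorem coeff_sum_monomial (c : (Fin n → σ) → R) (w : List σ) :
    coeff w (∑ i, c i • (List.ofFn fun k => (X (i k) : NCPowerSeries σ R)).prod) =
      ∑ i, if w = List.ofFn i then c i else 0 := by
  refine (Finset.sum_apply w _ _).trans (Finset.sum_congr rfl fun i _ => ?_)
  change c i * coeff w (List.ofFn (X ∘ i)).prod = _
  rw [← List.map_ofFn, coeff_prod_map_X, mul_ite, mul_one, mul_zero]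

theorem coeff_ofFn_sum_monomial (c : (Fin n → σ) → R) (i : Fin n → σ) :
    coeff (List.ofFn i) (∑ j, c j • (List.ofFn fun k => (X (j k) : NCPowerSeries σ R)).prod) =
      c i := by
  simp only [coeff_sum_monomial, List.ofFn_inj, Finset.sum_ite_eq, Finset.mem_univ, if_true]

theorem coeff_sum_monomial_of_length_ne (c : (Fin n → σ) → R) {w : List σ} (hw : w.length ≠ n) :
    coeff w (∑ i, c i • (List.ofFn fun k => (X (i k) : NCPowerSeries σ R)).prod) = 0 := by
  rw [coeff_sum_monomial]
  refine Finset.sum_eq_zero fun i _ => if_neg ?_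
  rintro rfl
  exact hw List.length_ofFn

theorem exists_expansion_of_mem_symmetricOrder {f : NCPowerSeries σ R}
    (hf : f ∈ symmetricOrder σ R n) :
    ∃ (c : (Fin n → σ) → R) (d : NCPowerSeries σ R),
      (∀ (i : Fin n → σ) (τ : Equiv.Perm (Fin n)), c (i ∘ τ) = c i) ∧
      (∀ w : List σ, w.length < n + 1 → d.coeff w = 0) ∧
      f = ∑ i : Fin n → σ, c i • (List.ofFn fun k => X (i k)).prod + d := by
  obtain ⟨hlow, hsymm⟩ := mem_symmetricOrder.1 hf
  let c (i : Fin n → σ) : R := coeff (List.ofFn i) f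
  refine ⟨c, f - ∑ i, c i • (List.ofFn fun k => X (i k)).prod, fun i τ => ?_, fun w hw => ?_,
    (add_sub_cancel _ _).symm⟩
  · exact hsymm _ _ List.length_ofFn (τ.ofFn_comp_perm i)
  · rw [sub_eq_add_neg, coeff_add, coeff_neg, add_neg_eq_zero]
    rcases (Nat.lt_succ_iff.1 hw).lt_or_eq with h | rfl
    · rw [mem_ofOrder.1 hlow w h, coeff_sum_monomial_of_length_ne c h.ne]
    · have h := (coeff_ofFn_sum_monomial c w.get).symm
      simpa only [c, List.ofFn_get] using h

end Monomial

end NCPowerSeries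

/-! ### Relators as laws of finite groups of exponent `n` -/

section Law

variable {m n k : ℕ}

theorem map_relator_eq_one_of_pow_card_le {α G : Type*} [Finite α] [Group G] [Finite G]
    {R : Set (FreeGroup α)} (h : Nat.card G ^ Nat.card α ≤ Nat.card (PresentedGroup R →* G))
    (φ : FreeGroup α →* G) {r : FreeGroup α} (hr : r ∈ R) : φ r = 1 := by
  let restrict (ψ : PresentedGroup R →* G) (a : α) : G := ψ (.of a)
  have hinj : restrict.Injective := fun ψ ψ' h => PresentedGroup.ext (congrFun h)
  obtain ⟨ψ, hψ⟩ := (hinj.bijective_of_nat_card_le (by rwa [Nat.card_fun])).2 fun a => φ (.of a)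
  have hφ : ψ.comp (PresentedGroup.mk R) = φ := FreeGroup.ext_hom _ _ (congrFun hψ)
  rw [← hφ, MonoidHom.comp_apply, PresentedGroup.one_of_mem hr, map_one]

theorem pow_le_card_hom_of_surjective {H : Type*} [Group H]
    [Finite (H →* Multiplicative (ZMod n))] {φ : H →* Multiplicative (Fin m → ZMod n)}
    (hφ : Function.Surjective φ) : n ^ m ≤ Nat.card (H →* Multiplicative (ZMod n)) := by
  let pullback (a : Fin m → ZMod n) : H →* Multiplicative (ZMod n) :=
    (Module.piEquiv (Fin m) (ZMod n) (ZMod n) a).toAddMonoidHom.toMultiplicative.comp φ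
  have hinj : pullback.Injective := fun a b h =>
    (Module.piEquiv _ _ _).injective <| LinearMap.toAddMonoidHom_injective <|
      AddMonoidHom.toMultiplicative.injective <| (MonoidHom.cancel_right hφ).1 h
  simpa [Nat.card_fun] using Nat.card_le_card_of_injective pullback hinj

namespace LinkDiagram

variable {D : LinkDiagram}

theorem exists_surjective_gammaQuotient (D : LinkDiagram) (n q : ℕ) :
    ∃ φ : D.CoreGroup →* GammaQuotient (D.UnreducedBurnside n) q, Function.Surjective φ := by
  let φ : D.CoreGroup →* D.UnreducedBurnside n :=
    PresentedGroup.map (MonoidHom.id _) fun _ => Or.inl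
  have hφ : Function.Surjective φ :=
    Function.Surjective.of_comp (g := PresentedGroup.mk _) (PresentedGroup.mk_surjective _)
  exact ⟨(QuotientGroup.mk' _).comp φ, (QuotientGroup.mk'_surjective _).comp hφ⟩

theorem card_hom_of_nMoveEquiv_trivial {G : Type} [Group G] (hG : ∀ g : G, g ^ n = 1)
    (h : Link.NMoveEquiv n D.link (Link.trivial k)) :
    Nat.card (D.CoreGroup →* G) = Nat.card G ^ k :=
  (h.cardHom_eq hG).trans (Link.cardHom_trivial k)

theorem le_of_nMoveEquiv_trivial (hn : 1 < n)
    (h : Link.NMoveEquiv n D.link (Link.trivial k))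
    {ψ : D.CoreGroup →* Multiplicative (Fin m → ZMod n)} (hψ : Function.Surjective ψ) :
    m ≤ k := by
  have : NeZero n := ⟨by omega⟩
  have hcard : Nat.card (D.CoreGroup →* Multiplicative (ZMod n)) = n ^ k := by
    have hexp (g : Multiplicative (ZMod n)) : g ^ n = 1 :=
      Multiplicative.toAdd.injective (by simp)
    simpa using card_hom_of_nMoveEquiv_trivial hexp h
  have : Finite (D.CoreGroup →* Multiplicative (ZMod n)) :=
    Nat.finite_of_card_ne_zero (hcard ▸ pow_ne_zero k (NeZero.ne n))
  exact (Nat.pow_le_pow_iff_right hn).1 (hcard ▸ pow_le_card_hom_of_surjective hψ)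

theorem map_relator_eq_one_of_nMoveEquiv_trivial (hn : 1 < n) {R : Set (FreeGroup (Fin m))}
    (e : D.CoreGroup ≃* PresentedGroup R) {ψ : D.CoreGroup →* Multiplicative (Fin m → ZMod n)}
    (hψ : Function.Surjective ψ) (h : Link.NMoveEquiv n D.link (Link.trivial k))
    {G : Type} [Group G] [Finite G] (hG : ∀ g : G, g ^ n = 1) (φ : FreeGroup (Fin m) →* G)
    {r : FreeGroup (Fin m)} (hr : r ∈ R) : φ r = 1 := by
  refine map_relator_eq_one_of_pow_card_le ?_ φ hr
  rw [← Nat.card_congr e.monoidHomCongrLeftEquiv, card_hom_of_nMoveEquiv_trivial hG h, Nat.card_fin]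
  exact Nat.pow_le_pow_right Nat.card_pos (le_of_nMoveEquiv_trivial hn h hψ)

end LinkDiagram

end Law

/-! ### The Magnus expansion modulo series with symmetric leading terms -/

section Magnus

variable {p m : ℕ}

theorem coeff_nil_magnus (w : FreeGroup (Fin m)) :
    NCPowerSeries.coeff [] (magnus p m w) = 1 := by
  have h : (NCPowerSeries.constantCoeff (Fin m) (ZMod p) : _ →* ZMod p).comp (magnus p m) = 1 :=
    FreeGroup.ext_hom _ _ fun i => by
      simp [magnus, NCPowerSeries.oneAddX, NCPowerSeries.constantCoeff_apply, NCPowerSeries.coeff_X]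
  exact DFunLike.congr_fun h w

/-- The Magnus expansion modulo the ideal of series of order at least `p` with symmetric terms of
degree `p`. Its range is a finite group of exponent `p`. -/
def magnusMod (p m : ℕ) : FreeGroup (Fin m) →*
    ((NCPowerSeries.symmetricOrder (Fin m) (ZMod p) p).ringCon.Quotient)ˣ :=
  MonoidHom.toHomUnits <|
    (NCPowerSeries.symmetricOrder (Fin m) (ZMod p) p).ringCon.mk'.toMonoidHom.comp (magnus p m)

theorem magnusMod_eq_one_iff {w : FreeGroup (Fin m)} :
    magnusMod p m w = 1 ↔ magnus p m w - 1 ∈ NCPowerSeries.symmetricOrder (Fin m) (ZMod p) p :=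
  Units.ext_iff.trans <| (RingCon.eq _).trans (TwoSidedIdeal.rel_iff _ _ _)

theorem magnusMod_range_pow_prime (hp : p.Prime) (g : (magnusMod p m).range) : g ^ p = 1 := by
  have : Fact p.Prime := ⟨hp⟩
  obtain ⟨_, w, rfl⟩ := g
  refine Subtype.ext ((map_pow (magnusMod p m) w p).symm.trans (magnusMod_eq_one_iff.2 ?_))
  rw [map_pow]
  exact NCPowerSeries.pow_char_sub_one_mem_symmetricOrder p (coeff_nil_magnus w)

end Magnus

theorem theorem3 (p : ℕ) (hp : p.Prime) (m : ℕ) (R : Set (FreeGroup (Fin m)))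
    (L : Link) (D : LinkDiagram) (hD : D.link = L)
    (hcore : Nonempty (D.CoreGroup ≃* PresentedGroup R))
    (hburnside : Nonempty (GammaQuotient (D.UnreducedBurnside p) 2 ≃*
      Multiplicative (Fin m → ZMod p)))
    (htriv : ∃ k : ℕ, Link.NMoveEquiv p L (Link.trivial k))
    (r : FreeGroup (Fin m)) (hr : r ∈ R) :
    ∃ (c : (Fin p → Fin m) → ZMod p) (d : NCPowerSeries (Fin m) (ZMod p)),
      (∀ (i : Fin p → Fin m) (σ : Equiv.Perm (Fin p)), c (i ∘ σ) = c i) ∧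
      (∀ w : List (Fin m), w.length < p + 1 → d.coeff w = 0) ∧
      magnus p m r =
        1 + ∑ i : Fin p → Fin m, c i • (List.ofFn fun k => NCPowerSeries.X (i k)).prod + d := by
  subst hD
  obtain ⟨e⟩ := hcore
  obtain ⟨e'⟩ := hburnside
  obtain ⟨k, hk⟩ := htriv
  have : NeZero p := ⟨hp.ne_zero⟩
  obtain ⟨ψ, hψ⟩ := D.exists_surjective_gammaQuotient p 2
  have hlaw : (magnusMod p m).rangeRestrict r = 1 :=
    LinkDiagram.map_relator_eq_one_of_nMoveEquiv_trivial hp.one_lt e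
      (ψ := e'.toMonoidHom.comp ψ) (e'.surjective.comp hψ) hk (magnusMod_range_pow_prime hp) _ hr
  obtain ⟨c, d, hc, hd, hr'⟩ := NCPowerSeries.exists_expansion_of_mem_symmetricOrder
    (magnusMod_eq_one_iff.1 (congrArg Subtype.val hlaw))
  exact ⟨c, d, hc, hd, by rw [add_assoc, ← hr', add_sub_cancel]⟩
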